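/- Let $\Sigma$ be a finite propositional signature. A rule $r$ over $\Sigma$ consists of a head $H(r)\subseteq\Sigma$ and a set $B(r)$ of body literals $a$, $not\,a$, $not\,not\,a$ with $a\in\Sigma$; $B^+(r),B^-(r),B^{--}(r)$ are the sets of atoms occurring in $B(r)$ positively, negated, doubly negated, and $\Sigma(r)$ is the set of all atoms occurring in $r$. A program is a finite set of rules. $\langle X,Y\rangle$ with $X\subseteq Y\subseteq\Sigma$ is an HT-model of $P$ if $Y\models P$ and $X\models P^Y$ classically, where $P^Y=\{H(r)\leftarrow B^+(r): r\in P,\ B^-(r)\cap Y=\emptyset,\ B^{--}(r)\subseteq Y\}$. *Normal form.* $NF(P)$ is obtained from $P$ by removing all rules with $H(r)\cap B^+(r)\neq\emptyset$, $B^+(r)\cap B^-(r)\ne\emptyset$ or $B^-(r)\cap B^{--}(r)\neq\emptyset$; then removing from each remaining rule every $not\,not\,a$ with $a\in B^+(r)$ from the body and every $a\in B^-(r)$ from the head; and finally removing every rule $r$ for which the program contains a rule $r'$ with $H(r')\subseteq H(r)$, $B(r')\subset B(r)$ or $H(r')\subset H(r)$, $B(r')\subseteq B(r)$. *Notation.*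 Let $q\in\Sigma$, $H^{\setminus q}(r)=H(r)\setminus\{q\}$, $B^{\setminus q}(r)=B(r)\setminus\{q,not\,q,not\,not\,q\}$. For a set $S$ of literals (atoms being literals), $not(S)$ and $not\,not(S)$ are the sets of negations and double negations of its elements, with $not\,not\,not\,p$ simplified to $not\,p$ and $not\,not\,not\,not\,p$ to $not\,not\,p$. $\mathcal D^q(Q)$ is the set of all sets $not(\{l_r: r\in F\})\cup not\,not(\{l_r: r\in T\})$, where $\langle F,T\rangle$ is a partition of $Q$ into two possibly empty parts, $l_r\in B^{\setminus q}(r)$ for $r\in F$ and $l_r\in H^{\setminus q}(r)$ for $r\in T$. *Syntactic operator.* Let $P'=NF(P)$, $R=\{r\in P': q\notin\Sigma(r)\}$, $R_0=\{r\in P': q\in B(r)\}$, $R_1=\{r\in P': not\,q\in B(r)\}$, $R_2=\{r\in P': not\,not\,q\in B(r),q\notin H(r)\}$, $R_3=\{r\in P': not\,not\,q\in B(r),q\in H(r)\}$, $R_4=\{r\in P': not\,not\,q\notin B(r),q\in H(r)\}$. Then $f_{SP}(P,q)=NF(P'')$, where $P''$ consists of the rules of $R$ and of the following rules, for all $r_0\in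 R_0$, $r_2\in R_2$, $r_3,r_3'\in R_3$, $r_4\in R_4$, $r'\in R_1\cup R_4$, $s\in R_0\cup R_2$: - (1a) $H(r_0)\cup H^{\setminus q}(r_4)\leftarrow B^{\setminus q}(r_0)\cup B(r_4)$; - (2a) $H(r_0)\cup H^{\setminus q}(r_3)\leftarrow B^{\setminus q}(r_0)\cup B^{\setminus q}(r_3)\cup not(H^{\setminus q}(r'))\cup not\,not(B^{\setminus q}(r'))$; - (3a) $H(r_0)\leftarrow B^{\setminus q}(r_0)\cup\{not\,not\,h\}\cup D\cup B^{\setminus q}(r_3)\cup not(H^{\setminus q}(r_3))$, for $h\in H(r_0)$, $D\in\mathcal D^q((R_0\cup R_2)\setminus\{r_0\})$; - (1b) $H(r_2)\leftarrow B^{\setminus q}(r_2)\cup not(H^{\setminus q}(r_4))\cup not\,not(B(r_4))$; - (2b) $H(r_2)\leftarrow B^{\setminus q}(r_2)\cup not(H^{\setminus q}(r_3)\cup H^{\setminus q}(r'))\cup not\,not(B^{\setminus q}(r_3)\cup B^{\setminus q}(r'))$; - (3b) $H(r_2)\leftarrow B^{\setminus q}(r_2)\cup not(H^{\setminus q}(r_3))\cup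 not\,not(B^{\setminus q}(r_3)\cup\{h\})\cup D$, for $h\in H(r_2)$, $D\in\mathcal D^q((R_0\cup R_2)\setminus\{r_2\})$; - (4) $H^{\setminus q}(r')\leftarrow B^{\setminus q}(r')\cup D$, for $D\in\mathcal D^q(R_3\cup R_4)$ with $D\cap not(B^{\setminus q}(r'))=\emptyset$; - (5) $H^{\setminus q}(r')\leftarrow B^{\setminus q}(r')\cup not(H(s)\cup H^{\setminus q}(r_3))\cup not\,not(B^{\setminus q}(s)\cup B^{\setminus q}(r_3))\cup D$, for $D\in\mathcal D^q(R_4)$ with $D\cap not(B^{\setminus q}(r'))=\emptyset$; - (6) $H^{\setminus q}(r')\leftarrow B^{\setminus q}(r')\cup not(H^{\setminus q}(r_3))\cup not\,not(B^{\setminus q}(r_3)\cup\{h\})\cup D$, for $h\in H^{\setminus q}(r')$, $D\in\mathcal D^q((R_1\cup R_4)\setminus\{r'\})$; - (7) $H(r_0)\cup H^{\setminus q}(r_3)\leftarrow B^{\setminus q}(r_0)\cup B^{\setminus q}(r_3)\cup not(H^{\setminus q}(r_3'))\cup not\,not(B^{\setminus q}(r_3')\cup\{h\})\cup D$, for $r_3\ne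 r_3'$, $h\in H(r_0)$, $D\in\mathcal D^q((R_0\cup R_2)\setminus\{r_0\})$. *Semantic operator.* Put $V=\{q\}$. For $Y\subseteq\Sigma\setminus V$ let $\mathcal R^Y$ be the family of all sets $\{X\setminus V:\langle X,Y\cup A\rangle\text{ is an HT-model of }P\}$, where $A\subseteq V$ is such that $\langle Y\cup A,Y\cup A\rangle$ is an HT-model of $P$ and there is no $A'\subset A$ for which $\langle Y\cup A',Y\cup A\rangle$ is one. Let $M$ be the set of all $\langle X,Y\rangle$ such that $Y\subseteq\Sigma\setminus V$, $\mathcal R^Y\neq\emptyset$ and $X\in\bigcap\mathcal R^Y$. With $r_{X,Y}$ the rule $(Y\setminus X)\leftarrow X\cup not((\Sigma\setminus V)\setminus Y)\cup not\,not(Y\setminus X)$, let $$f_{Sem}(P,q)=\{r_{X,Y}: X\subseteq Y\subseteq\Sigma\setminus V,\ \langle X,Y\rangle\notin M,\ \langle Y,Y\rangle\in M\}\cup\{r_{Y,Y}: Y\subseteq\Sigma\setminus V,\ \langle Y,Y\rangle\notin M\}.$$ **Proposition.** Let $P$ be a program over $\Sigma$ and $q\in\Sigma$. For each rule $r\in f_{SP}(P,q)$,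 the program $f_{Sem}(P,q)$ contains at least $2^D$ rules, where $D=\min(|H(r)|,\,|(\Sigma\setminus\{q\})\setminus\Sigma(r)|)$. If moreover $H(r)\not\subseteq B^{--}(r)$, then the same holds with $D=\min(|H(r)|,\,|\Sigma\setminus\Sigma(r)|)$. -/

import Mathlib

namespace ASPForget

/-- Body literals `a`, `not a`, `not not a` over a propositional signature `σ`. -/
inductive Lit (σ : Type*) where
  | pos (a : σ) : Lit σ
  | neg (a : σ) : Lit σ
  | nneg (a : σ) : Lit σ

namespace Lit

variable {σ : Type*}

/-- The atom of a literal. -/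
def atom : Lit σ → σ
  | pos a => a
  | neg a => a
  | nneg a => a

/-- Negation of a literal, with `not not not p` simplified to `not p`. -/
def naf : Lit σ → Lit σ
  | pos a => neg a
  | neg a => nneg a
  | nneg a => neg a

/-- Double negation of a literal, with `not not not p` simplified to `not p` and
`not not not not p` simplified to `not not p`. -/
def nnaf : Lit σ → Lit σ
  | pos a => nneg a
  | neg a => neg a
  | nneg a => nneg a

/-- Classical truth of a literal in an interpretation. -/
def Sat (I : Set σ) : Lit σ → Prop
  | pos a => a ∈ I
  | neg a => a ∉ I
  | nneg a => ¬ a ∉ I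

end Lit

/-- A rule `H(r) ← B(r)`: a set of head atoms and a set of body literals.
The signature is always finite below, so that rules are finite objects. -/
@[ext] structure Rule (σ : Type*) where
  head : Set σ
  body : Set (Lit σ)

/-- A logic program over the signature `σ`; for finite `σ` it is automatically a finite set. -/
abbrev Program (σ : Type*) := Set (Rule σ)

variable {σ : Type*}

/-- `not (S)`, for a set `S` of literals. -/
def naf (S : Set (Lit σ)) : Set (Lit σ) := Lit.naf '' S

/-- `not not (S)`, for a set `S` of literals. -/
def nnaf (S : Set (Lit σ)) : Set (Lit σ) := Lit.nnaf '' S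

/-- A set of atoms, seen as a set of (positive) literals. -/
def atomLits (A : Set σ) : Set (Lit σ) := Lit.pos '' A

namespace Rule

/-- `B⁺(r)`. -/
def pbody (r : Rule σ) : Set σ := {a | Lit.pos a ∈ r.body}

/-- `B⁻(r)`. -/
def nbody (r : Rule σ) : Set σ := {a | Lit.neg a ∈ r.body}

/-- `B⁻⁻(r)`. -/
def nnbody (r : Rule σ) : Set σ := {a | Lit.nneg a ∈ r.body}

/-- `Σ(r)`: the atoms occurring in the rule. -/
def atoms (r : Rule σ) : Set σ := r.head ∪ Lit.atom '' r.body

/-- The head without `q`. -/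
def headWo (q : σ) (r : Rule σ) : Set σ := r.head \ {q}

/-- The body without `q`, `not q`, `not not q`. -/
def bodyWo (q : σ) (r : Rule σ) : Set (Lit σ) := r.body \ {Lit.pos q, Lit.neg q, Lit.nneg q}

/-- Classical satisfaction of a rule. -/
def Sat (I : Set σ) (r : Rule σ) : Prop := (∀ l ∈ r.body, l.Sat I) → ∃ a ∈ r.head, a ∈ I

def Tautological (r : Rule σ) : Prop :=
  (r.head ∩ r.pbody).Nonempty ∨ (r.pbody ∩ r.nbody).Nonempty ∨ (r.nbody ∩ r.nnbody).Nonempty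

/-- Remove `not not a` from the body whenever `a` is in the body, and remove `a` from the head
whenever `not a` is in the body. -/
def simplify (r : Rule σ) : Rule σ where
  head := r.head \ r.nbody
  body := r.body \ (Lit.nneg '' r.pbody)

/-- The rule `r` is minimal with respect to the program `P`. -/
def MinimalIn (P : Program σ) (r : Rule σ) : Prop :=
  ¬ ∃ r' ∈ P, (r'.head ⊆ r.head ∧ r'.body ⊂ r.body) ∨ (r'.head ⊂ r.head ∧ r'.body ⊆ r.body)

end Rule

namespace Program

/-- Classical satisfaction of a program. -/
def Sat (I : Set σ) (P : Program σ) : Prop := ∀ r ∈ P, r.Sat I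

/-- The reduct `P^I`. -/
def reduct (P : Program σ) (I : Set σ) : Program σ :=
  {s | ∃ r ∈ P, r.nbody ∩ I = ∅ ∧ r.nnbody ⊆ I ∧ s = ⟨r.head, atomLits r.pbody⟩}

/-- `⟨X, Y⟩` is an HT-model of `P`. -/
def IsHTModel (P : Program σ) (X Y : Set σ) : Prop :=
  X ⊆ Y ∧ Program.Sat Y P ∧ Program.Sat X (reduct P Y)

/-- The non-tautological rules of `P`, simplified. -/
def simplified (P : Program σ) : Program σ := Rule.simplify '' {r ∈ P | ¬ r.Tautological}

/-- The normal form `NF(P)`. -/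
def NF (P : Program σ) : Program σ := {r ∈ simplified P | r.MinimalIn (simplified P)}

/-! The classes of rules of `P`, according to the way in which `q` occurs in them. -/

def R (P : Program σ) (q : σ) : Program σ := {r ∈ P | q ∉ r.atoms}

def R0 (P : Program σ) (q : σ) : Program σ := {r ∈ P | Lit.pos q ∈ r.body}

def R1 (P : Program σ) (q : σ) : Program σ := {r ∈ P | Lit.neg q ∈ r.body}

def R2 (P : Program σ) (q : σ) : Program σ := {r ∈ P | Lit.nneg q ∈ r.body ∧ q ∉ r.head}

def R3 (P : Program σ) (q : σ) : Program σ := {r ∈ P | Lit.nneg q ∈ r.body ∧ q ∈ r.head}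

def R4 (P : Program σ) (q : σ) : Program σ := {r ∈ P | Lit.nneg q ∉ r.body ∧ q ∈ r.head}

/-- The as-dual of `P` with respect to `q`: for a partition of `P` into `F` and `T` (either may be
empty), pick one body literal (without `q`) of each rule in `F` and one head atom (other than `q`)
of each rule in `T`; collect the negations of the former and the double negations of the latter. -/
def asDual (q : σ) (P : Program σ) : Set (Set (Lit σ)) :=
  {D | ∃ F T : Program σ, F ∪ T = P ∧ Disjoint F T ∧ ∃ l : Rule σ → Lit σ,
    (∀ r ∈ F, l r ∈ r.bodyWo q) ∧ (∀ r ∈ T, l r ∈ atomLits (r.headWo q)) ∧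
    D = naf (l '' F) ∪ nnaf (l '' T)}

/-- The rules obtained from a program `P` (in normal form) by the derivation rules for forgetting
about `q`. -/
inductive Derived (P : Program σ) (q : σ) : Rule σ → Prop
  | keep (r : Rule σ) (hr : r ∈ R P q) : Derived P q r
  | d1a (r₀ r₄ : Rule σ) (h₀ : r₀ ∈ R0 P q) (h₄ : r₄ ∈ R4 P q) :
      Derived P q ⟨r₀.head ∪ r₄.headWo q, r₀.bodyWo q ∪ r₄.body⟩
  | d2a (r₀ r₃ r' : Rule σ) (h₀ : r₀ ∈ R0 P q) (h₃ : r₃ ∈ R3 P q) (h' : r' ∈ R1 P q ∪ R4 P q) :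
      Derived P q ⟨r₀.head ∪ r₃.headWo q,
        r₀.bodyWo q ∪ r₃.bodyWo q ∪ naf (atomLits (r'.headWo q)) ∪ nnaf (r'.bodyWo q)⟩
  | d3a (r₀ r₃ : Rule σ) (a : σ) (D : Set (Lit σ)) (h₀ : r₀ ∈ R0 P q) (h₃ : r₃ ∈ R3 P q)
      (ha : a ∈ r₀.head) (hD : D ∈ asDual q ((R0 P q ∪ R2 P q) \ {r₀})) :
      Derived P q ⟨r₀.head,
        r₀.bodyWo q ∪ {Lit.nneg a} ∪ D ∪ r₃.bodyWo q ∪ naf (atomLits (r₃.headWo q))⟩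
  | d1b (r₂ r₄ : Rule σ) (h₂ : r₂ ∈ R2 P q) (h₄ : r₄ ∈ R4 P q) :
      Derived P q ⟨r₂.head, r₂.bodyWo q ∪ naf (atomLits (r₄.headWo q)) ∪ nnaf r₄.body⟩
  | d2b (r₂ r₃ r' : Rule σ) (h₂ : r₂ ∈ R2 P q) (h₃ : r₃ ∈ R3 P q) (h' : r' ∈ R1 P q ∪ R4 P q) :
      Derived P q ⟨r₂.head,
        r₂.bodyWo q ∪ naf (atomLits (r₃.headWo q ∪ r'.headWo q)) ∪
          nnaf (r₃.bodyWo q ∪ r'.bodyWo q)⟩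
  | d3b (r₂ r₃ : Rule σ) (a : σ) (D : Set (Lit σ)) (h₂ : r₂ ∈ R2 P q) (h₃ : r₃ ∈ R3 P q)
      (ha : a ∈ r₂.head) (hD : D ∈ asDual q ((R0 P q ∪ R2 P q) \ {r₂})) :
      Derived P q ⟨r₂.head,
        r₂.bodyWo q ∪ naf (atomLits (r₃.headWo q)) ∪ nnaf (r₃.bodyWo q ∪ {Lit.pos a}) ∪ D⟩
  | d4 (r' : Rule σ) (D : Set (Lit σ)) (h' : r' ∈ R1 P q ∪ R4 P q)
      (hD : D ∈ asDual q (R3 P q ∪ R4 P q)) (hdisj : D ∩ naf (r'.bodyWo q) = ∅) :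
      Derived P q ⟨r'.headWo q, r'.bodyWo q ∪ D⟩
  | d5 (r' r₃ r : Rule σ) (D : Set (Lit σ)) (h' : r' ∈ R1 P q ∪ R4 P q) (h₃ : r₃ ∈ R3 P q)
      (hr : r ∈ R0 P q ∪ R2 P q) (hD : D ∈ asDual q (R4 P q))
      (hdisj : D ∩ naf (r'.bodyWo q) = ∅) :
      Derived P q ⟨r'.headWo q,
        r'.bodyWo q ∪ naf (atomLits (r.head ∪ r₃.headWo q)) ∪
          nnaf (r.bodyWo q ∪ r₃.bodyWo q) ∪ D⟩
  | d6 (r' r₃ : Rule σ) (a : σ) (D : Set (Lit σ)) (h' : r' ∈ R1 P q ∪ R4 P q) (h₃ : r₃ ∈ R3 P q)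
      (ha : a ∈ r'.headWo q) (hD : D ∈ asDual q ((R1 P q ∪ R4 P q) \ {r'})) :
      Derived P q ⟨r'.headWo q,
        r'.bodyWo q ∪ naf (atomLits (r₃.headWo q)) ∪ nnaf (r₃.bodyWo q ∪ {Lit.pos a}) ∪ D⟩
  | d7 (r₀ r₃ r₃' : Rule σ) (a : σ) (D : Set (Lit σ)) (h₀ : r₀ ∈ R0 P q) (h₃ : r₃ ∈ R3 P q)
      (h₃' : r₃' ∈ R3 P q) (hne : r₃ ≠ r₃') (hD : D ∈ asDual q ((R0 P q ∪ R2 P q) \ {r₀}))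
      (ha : a ∈ r₀.head) :
      Derived P q ⟨r₀.head ∪ r₃.headWo q,
        r₀.bodyWo q ∪ r₃.bodyWo q ∪ naf (atomLits (r₃'.headWo q)) ∪
          nnaf (r₃'.bodyWo q ∪ {Lit.pos a}) ∪ D⟩

/-- The syntactic operator: the result of forgetting about `q` from `P`. -/
def fSP (P : Program σ) (q : σ) : Program σ := NF {r | Derived (NF P) q r}

/-- `R^{Y,A}` for the forgetting instance `⟨P, V⟩`. -/
def relModels (P : Program σ) (V Y A : Set σ) : Set (Set σ) :=
  {Z | ∃ X, IsHTModel P X (Y ∪ A) ∧ Z = X \ V}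

/-- `Rel^Y` for the forgetting instance `⟨P, V⟩`. -/
def Rel (P : Program σ) (V Y : Set σ) : Set (Set σ) :=
  {A | A ⊆ V ∧ IsHTModel P (Y ∪ A) (Y ∪ A) ∧ ¬ ∃ A', A' ⊂ A ∧ IsHTModel P (Y ∪ A') (Y ∪ A)}

/-- `𝓡^Y` for the forgetting instance `⟨P, V⟩`. -/
def relFamily (P : Program σ) (V Y : Set σ) : Set (Set (Set σ)) := relModels P V Y '' Rel P V Y

/-- The HT-interpretations `⟨X, Y⟩` over `Σ \ V` that are prescribed as the HT-models of a result of
forgetting about `V` from `P`: `X` is in the intersection of `𝓡^Y`, where the intersection of the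
empty family contains nothing. -/
def forgetModels (P : Program σ) (V : Set σ) : Set (Set σ × Set σ) :=
  {p | p.2 ⊆ Vᶜ ∧ (relFamily P V p.2).Nonempty ∧ p.1 ∈ ⋂₀ relFamily P V p.2}

/-- The counter-model rule `r_{X,Y}` over the signature `S`:
`(Y \ X) ← X, not (S \ Y), not not (Y \ X)`.
For `X = Y` this is the constraint `← Y, not (S \ Y)`. -/
def counterRule (S X Y : Set σ) : Rule σ :=
  ⟨Y \ X, atomLits X ∪ naf (atomLits (S \ Y)) ∪ nnaf (atomLits (Y \ X))⟩

/-- The semantic operator, given by the counter-model construction over the signature `Σ \ V` of the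
result of forgetting. -/
def fSem (P : Program σ) (V : Set σ) : Program σ :=
  {r | ∃ X Y : Set σ, X ⊆ Y ∧ Y ⊆ Vᶜ ∧ (X, Y) ∉ forgetModels P V ∧ (Y, Y) ∈ forgetModels P V ∧
    r = counterRule Vᶜ X Y} ∪
  {r | ∃ Y : Set σ, Y ⊆ Vᶜ ∧ (Y, Y) ∉ forgetModels P V ∧ r = counterRule Vᶜ Y Y}

end Program

/-- Over a finite signature there are finitely many rules, so that cardinalities of programs are
genuine. -/
instance instFiniteRule [Finite σ] : Finite (Rule σ) := by
  have hL : Finite (Lit σ) := by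
    refine Finite.of_surjective (α := σ ⊕ σ ⊕ σ)
      (fun x => match x with
        | Sum.inl a => Lit.pos a
        | Sum.inr (Sum.inl a) => Lit.neg a
        | Sum.inr (Sum.inr a) => Lit.nneg a) ?_
    intro l
    cases l with
    | pos a => exact ⟨Sum.inl a, rfl⟩
    | neg a => exact ⟨Sum.inr (Sum.inl a), rfl⟩
    | nneg a => exact ⟨Sum.inr (Sum.inr a), rfl⟩
  refine Finite.of_injective (β := Set σ × Set (Lit σ)) (fun r => (r.head, r.body)) ?_
  intro r s h
  simp only [Prod.mk.injEq] at h
  exact Rule.ext h.1 h.2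

end ASPForget

/-! Only one half of the correctness of the syntactic operator is needed: every prescribed pair in
`forgetModels P {q}` satisfies, in the HT sense, every rule of `fSP P q` (`hSat_of_mem_fSP`).
Contrapositively, each HT-countermodel of `r` over the reduced signature is excluded, and the
semantic operator spends a rule on it or, if the total pair ⟨Y, Y⟩ is itself excluded, on Y.

A rule in normal form has many countermodels. Take X = B⁺(r) and Y = B⁺(r) ∪ B⁻⁻(r) ∪ S, where S is
any set of atoms other than q not occurring in the body. The body holds at ⟨X, Y⟩ and the head
fails, being disjoint from B⁺(r). Different S give different Y, and Y can be read off a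
counter-model rule as head plus positive body, so there are at least 2^|W| rules when S ranges over
the subsets of W (`two_pow_le_ncard_fSem`).

For the first bound W consists of the atoms outside Σ(r) other than q. For the second, a head atom
outside B⁻⁻(r) does not occur in the body at all; adding it to W makes up for the missing q. The cap
|H(r)| in the exponent only weakens the bounds.

Soundness rests on `forgetModel_of_mem`, which translates membership among the prescribed pairs into
conditions on the classes R, R0, …, R4, and on `Derived.hSat`, which checks each derivation rule
against them. -/

namespace ASPForget

/-! ### HT satisfaction of literals and rules. -/

namespace Lit

variable {σ : Type*}

/-- Truth of a literal at the "here" world of the HT-interpretation `⟨X, Y⟩`. -/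
def HSat (X Y : Set σ) : Lit σ → Prop
  | pos a => a ∈ X
  | neg a => a ∉ Y
  | nneg a => a ∈ Y

@[simp] theorem hSat_pos {X Y : Set σ} {a : σ} : (pos a).HSat X Y ↔ a ∈ X := Iff.rfl

@[simp] theorem hSat_neg {X Y : Set σ} {a : σ} : (neg a).HSat X Y ↔ a ∉ Y := Iff.rfl

@[simp] theorem hSat_nneg {X Y : Set σ} {a : σ} : (nneg a).HSat X Y ↔ a ∈ Y := Iff.rfl

theorem HSat.mono {X Y : Set σ} (hXY : X ⊆ Y) {l : Lit σ} (h : l.HSat X Y) : l.HSat Y Y := by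
  cases l with
  | pos a => exact hXY h
  | neg a => exact h
  | nneg a => exact h

theorem hSat_self_iff {Y : Set σ} {l : Lit σ} : l.HSat Y Y ↔ l.Sat Y := by
  cases l <;> simp [HSat, Sat]

theorem hSat_naf {X Y : Set σ} {l : Lit σ} : l.naf.HSat X Y ↔ ¬ l.HSat Y Y := by
  cases l <;> simp [HSat, naf]

theorem hSat_nnaf {X Y : Set σ} {l : Lit σ} : l.nnaf.HSat X Y ↔ l.HSat Y Y := by
  cases l <;> simp [HSat, nnaf]

@[simp] theorem atom_naf (l : Lit σ) : l.naf.atom = l.atom := by cases l <;> rfl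

@[simp] theorem atom_nnaf (l : Lit σ) : l.nnaf.atom = l.atom := by cases l <;> rfl

theorem hSat_union_iff {q : σ} {X Y A B : Set σ} (hA : A ⊆ {q}) (hB : B ⊆ {q}) {l : Lit σ}
    (hl : l.atom ≠ q) : l.HSat (X ∪ A) (Y ∪ B) ↔ l.HSat X Y := by
  have hA' : l.atom ∉ A := fun h => hl (hA h)
  have hB' : l.atom ∉ B := fun h => hl (hB h)
  cases l <;> simp_all [HSat, atom]

end Lit

variable {σ : Type*}

namespace Rule

/-- Satisfaction of a rule at the "here" world of the HT-interpretation `⟨X, Y⟩`. -/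
def HSat (X Y : Set σ) (r : Rule σ) : Prop :=
  (∀ l ∈ r.body, l.HSat X Y) → ∃ a ∈ r.head, a ∈ X

/-- Satisfaction at the "here" world of `⟨X, Y⟩`, where all occurrences of `q` are dropped. -/
def HSatWo (q : σ) (X Y : Set σ) (r : Rule σ) : Prop :=
  (∀ l ∈ r.bodyWo q, l.HSat X Y) → ∃ a ∈ r.headWo q, a ∈ X

/-- The properties of a single rule of a program in normal form. -/
structure Reduced (r : Rule σ) : Prop where
  head_pos : ∀ a ∈ r.head, Lit.pos a ∉ r.body
  head_neg : ∀ a ∈ r.head, Lit.neg a ∉ r.body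
  pos_neg : ∀ a, Lit.pos a ∈ r.body → Lit.neg a ∉ r.body
  pos_nneg : ∀ a, Lit.pos a ∈ r.body → Lit.nneg a ∉ r.body
  neg_nneg : ∀ a, Lit.neg a ∈ r.body → Lit.nneg a ∉ r.body

theorem Reduced.simplify {r : Rule σ} (hr : ¬ r.Tautological) : r.simplify.Reduced := by
  simp only [Tautological, Set.Nonempty, Set.mem_inter_iff, not_or, not_exists, not_and] at hr
  obtain ⟨h1, h2, h3⟩ := hr
  refine ⟨fun a ha hb => h1 a ha.1 hb.1, fun a ha hb => ha.2 hb.1,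
    fun a ha hb => h2 a ha.1 hb.1, fun a ha hb => hb.2 ⟨a, ha.1, rfl⟩,
    fun a ha hb => h3 a ha.1 hb.1⟩

/-- Persistence X ⊆ Y is what makes both deletions harmless: `a` here implies `not not a`, and under
a true `not a` the head atom `a` cannot be true here. -/
theorem hSat_simplify_iff {X Y : Set σ} (hXY : X ⊆ Y) {r : Rule σ} :
    r.simplify.HSat X Y ↔ r.HSat X Y := by
  constructor
  · intro h hb
    obtain ⟨a, ha, haX⟩ := h fun l hl => hb l hl.1
    exact ⟨a, ha.1, haX⟩
  · intro h hb
    have hb' : ∀ l ∈ r.body, l.HSat X Y := by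
      intro l hl
      by_cases hmem : l ∈ Lit.nneg '' r.pbody
      · obtain ⟨a, ha, rfl⟩ := hmem
        exact hXY (hb (Lit.pos a) ⟨ha, by simp⟩)
      · exact hb l ⟨hl, hmem⟩
    obtain ⟨a, ha, haX⟩ := h hb'
    exact ⟨a, ⟨ha, fun hn => hb' _ hn (hXY haX)⟩, haX⟩

theorem Tautological.hSat {X Y : Set σ} (hXY : X ⊆ Y) {r : Rule σ} (hr : r.Tautological) :
    r.HSat X Y := by
  intro hb
  rcases hr with ⟨a, ha, hp⟩ | ⟨a, hp, hn⟩ | ⟨a, hn, hnn⟩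
  · exact ⟨a, ha, hb _ hp⟩
  · exact absurd (hXY (hb _ hp)) (hb _ hn)
  · exact absurd (hb _ hnn) (hb _ hn)

theorem HSat.mono {X Y : Set σ} {r s : Rule σ} (hh : r.head ⊆ s.head) (hb : r.body ⊆ s.body)
    (hr : r.HSat X Y) : s.HSat X Y := fun h =>
  let ⟨a, ha, haX⟩ := hr fun l hl => h l (hb hl)
  ⟨a, hh ha, haX⟩

theorem sat_iff_hSat {Y : Set σ} {r : Rule σ} : r.Sat Y ↔ r.HSat Y Y := by
  simp only [Sat, HSat, Lit.hSat_self_iff]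

theorem mem_bodyWo {q : σ} {r : Rule σ} {l : Lit σ} :
    l ∈ r.bodyWo q ↔ l ∈ r.body ∧ l.atom ≠ q := by
  simp only [bodyWo, Set.mem_sdiff, Set.mem_insert_iff, Set.mem_singleton_iff]
  cases l <;> simp [Lit.atom]

theorem hSatWo_iff_hSat {q : σ} {X Y : Set σ} {r : Rule σ} (hq : q ∉ r.atoms) :
    r.HSatWo q X Y ↔ r.HSat X Y := by
  have hh : r.headWo q = r.head := Set.sdiff_singleton_eq_self fun h => hq (Or.inl h)
  have hb : r.bodyWo q = r.body := by
    ext l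
    rw [mem_bodyWo, and_iff_left_iff_imp]
    rintro hl rfl
    exact hq (Or.inr ⟨l, hl, rfl⟩)
  rw [HSatWo, HSat, hh, hb]

/-- Once `A` and `B` fix the status of q here and there, every literal on q is a constant: either
the rule holds trivially or it amounts to its q-free part. -/
theorem hSat_union_iff {q : σ} {X Y A B : Set σ} (hX : q ∉ X) (hY : q ∉ Y) (hA : A ⊆ {q})
    (hB : B ⊆ {q}) {r : Rule σ} :
    r.HSat (X ∪ A) (Y ∪ B) ↔
      ((Lit.pos q ∈ r.body → q ∈ A) → (Lit.neg q ∈ r.body → q ∉ B) →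
        (Lit.nneg q ∈ r.body → q ∈ B) → ¬ (q ∈ r.head ∧ q ∈ A) → r.HSatWo q X Y) := by
  constructor
  · intro h hp hn hnn hhd hb
    obtain ⟨a, ha, haX⟩ := h (by
      intro l hl
      by_cases hlq : l.atom = q
      · cases l with
        | pos a => cases hlq; exact Or.inr (hp hl)
        | neg a => cases hlq; exact fun h' => h'.elim hY (hn hl)
        | nneg a => cases hlq; exact Or.inr (hnn hl)
      · exact (Lit.hSat_union_iff hA hB hlq).2 (hb l (mem_bodyWo.2 ⟨hl, hlq⟩)))
    rcases haX with haX | haA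
    · exact ⟨a, ⟨ha, by rintro rfl; exact hX haX⟩, haX⟩
    · obtain rfl := hA haA
      exact absurd ⟨ha, haA⟩ hhd
  · intro h hb
    by_cases hhd : q ∈ r.head ∧ q ∈ A
    · exact ⟨q, hhd.1, Or.inr hhd.2⟩
    · obtain ⟨a, ha, haX⟩ := h (fun hl => (hb _ hl).resolve_left hX)
        (fun hl hq => hb _ hl (Or.inr hq)) (fun hl => (hb _ hl).resolve_left hY) hhd
        (fun l hl => by
          rw [mem_bodyWo] at hl
          exact (Lit.hSat_union_iff hA hB hl.2).1 (hb l hl.1))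
      exact ⟨a, ha.1, Or.inl haX⟩

end Rule

/-! ### HT-models and their invariance under the normal form. -/

namespace Program

/-- The reduct evaluates the negated literals at Y and leaves the positive ones for X, which is
exactly evaluation at the "here" world. -/
theorem isHTModel_iff {P : Program σ} {X Y : Set σ} :
    IsHTModel P X Y ↔ X ⊆ Y ∧ ∀ r ∈ P, r.HSat Y Y ∧ r.HSat X Y := by
  have key : Program.Sat X (reduct P Y) ↔ ∀ r ∈ P, r.HSat X Y := by
    constructor
    · intro h r hr hb
      refine h ⟨r.head, atomLits r.pbody⟩ ⟨r, hr, ?_, fun a ha => hb _ ha, rfl⟩ ?_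
      · rw [Set.eq_empty_iff_forall_notMem]
        exact fun a ha => hb _ ha.1 ha.2
      · rintro _ ⟨a, ha, rfl⟩
        exact hb _ ha
    · rintro h _ ⟨r, hr, hn, hnn, rfl⟩ hb
      refine h r hr fun l hl => ?_
      cases l with
      | pos a => exact hb _ ⟨a, hl, rfl⟩
      | neg a => exact fun haY => (Set.eq_empty_iff_forall_notMem.1 hn a) ⟨hl, haY⟩
      | nneg a => exact hnn hl
  rw [IsHTModel, key, Program.Sat]
  simp only [Rule.sat_iff_hSat, forall_and]

theorem reduced_of_mem_NF {P : Program σ} {r : Rule σ} (hr : r ∈ NF P) : r.Reduced := by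
  obtain ⟨⟨s, hs, rfl⟩, -⟩ := hr
  exact .simplify hs.2

theorem exists_mem_NF_le [Finite σ] {P : Program σ} {r : Rule σ} (hr : r ∈ simplified P) :
    ∃ s ∈ NF P, s.head ⊆ r.head ∧ s.body ⊆ r.body := by
  let f : Rule σ → Set σ × Set (Lit σ) := fun r => (r.head, r.body)
  have hfin : {s ∈ simplified P | f s ≤ f r}.Finite := Set.toFinite _
  -- Finiteness yields a minimal subsumer of `r` in the product order on (head, body); that order's
  -- strict descents include those forbidden by `MinimalIn`.
  obtain ⟨s, hs, hmin⟩ := hfin.exists_minimalFor f _ ⟨r, hr, le_rfl⟩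
  refine ⟨s, ⟨hs.1, ?_⟩, hs.2.1, hs.2.2⟩
  rintro ⟨t, ht, hlt⟩
  have hle : f t ≤ f s := hlt.elim (fun h => ⟨h.1, h.2.1⟩) fun h => ⟨h.1.1, h.2⟩
  have hge := hmin ⟨ht, hle.trans hs.2⟩ hle
  exact hlt.elim (fun h => h.2.2 hge.2) fun h => h.1.2 hge.1

theorem forall_NF_hSat_iff [Finite σ] {P : Program σ} {X Y : Set σ} (hXY : X ⊆ Y) :
    (∀ r ∈ NF P, r.HSat X Y) ↔ ∀ r ∈ P, r.HSat X Y := by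
  constructor
  · intro h r hr
    by_cases ht : r.Tautological
    · exact ht.hSat hXY
    · obtain ⟨s, hs, hh, hb⟩ := exists_mem_NF_le (P := P) ⟨r, ⟨hr, ht⟩, rfl⟩
      exact (Rule.hSat_simplify_iff hXY).1 ((h s hs).mono hh hb)
  · rintro h _ ⟨⟨r, hr, rfl⟩, -⟩
    exact (Rule.hSat_simplify_iff hXY).2 (h r hr.1)

theorem isHTModel_NF_iff [Finite σ] {P : Program σ} {X Y : Set σ} :
    IsHTModel (NF P) X Y ↔ IsHTModel P X Y := by
  simp only [isHTModel_iff, forall_and, and_congr_right_iff]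
  intro hXY
  rw [forall_NF_hSat_iff hXY, forall_NF_hSat_iff subset_rfl]

theorem forgetModels_NF [Finite σ] (P : Program σ) (V : Set σ) :
    forgetModels (NF P) V = forgetModels P V := by
  have h : relModels (NF P) V = relModels P V := by
    funext Y A
    simp only [relModels, isHTModel_NF_iff]
  simp only [forgetModels, relFamily, h, Rel, isHTModel_NF_iff]

/-! ### Prescribed models in terms of the rule classes. -/

section Classes

variable {Q : Program σ} {q : σ} {X Y : Set σ}

/-- With q false at both worlds, a positive or doubly negated q in the body makes a rule vacuous, so
only R, R1 and R4 impose conditions. -/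
theorem isHTModel_empty_empty_iff (hQ : ∀ r ∈ Q, r.Reduced) (hXY : X ⊆ Y) (hq : q ∉ Y) :
    IsHTModel Q (X ∪ ∅) (Y ∪ ∅) ↔
      ∀ r ∈ R Q q ∪ (R1 Q q ∪ R4 Q q), r.HSatWo q Y Y ∧ r.HSatWo q X Y := by
  have hqX : q ∉ X := fun h => hq (hXY h)
  rw [isHTModel_iff, and_iff_right (Set.union_subset_union_left _ hXY)]
  simp only [Rule.hSat_union_iff hq hq (Set.empty_subset _) (Set.empty_subset _),
    Rule.hSat_union_iff hqX hq (Set.empty_subset _) (Set.empty_subset _),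
    Set.mem_empty_iff_false, imp_false, not_false_eq_true, implies_true, and_false,
    forall_const]
  constructor
  · rintro h r hr
    have hp : Lit.pos q ∉ r.body ∧ Lit.nneg q ∉ r.body := by
      rcases hr with hr | hr | hr
      · exact ⟨fun h => hr.2 (Or.inr ⟨_, h, rfl⟩), fun h => hr.2 (Or.inr ⟨_, h, rfl⟩)⟩
      · exact ⟨fun h => (hQ r hr.1).pos_neg q h hr.2, (hQ r hr.1).neg_nneg q hr.2⟩
      · exact ⟨(hQ r hr.1).head_pos q hr.2.2, hr.2.1⟩
    have hrQ : r ∈ Q := by rcases hr with hr | hr | hr <;> exact hr.1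
    exact ⟨(h r hrQ).1 hp.1 hp.2, (h r hrQ).2 hp.1 hp.2⟩
  · intro h r hr
    rw [← imp_and, ← imp_and]
    intro hp hnn
    refine h r ?_
    by_cases hn : Lit.neg q ∈ r.body
    · exact Or.inr (Or.inl ⟨hr, hn⟩)
    by_cases hh : q ∈ r.head
    · exact Or.inr (Or.inr ⟨hr, hnn, hh⟩)
    · refine Or.inl ⟨hr, ?_⟩
      rintro (h' | ⟨l, hl, hlq⟩)
      · exact hh h'
      · cases l <;> cases hlq <;> contradiction

/-- The rules whose `q`-free part has to hold when `q` is true are those in which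
`q` does not occur negated in the body or in the head. -/
theorem mem_R_union_R0_union_R2_iff (hQ : ∀ r ∈ Q, r.Reduced) {r : Rule σ} :
    r ∈ R Q q ∪ (R0 Q q ∪ R2 Q q) ↔ r ∈ Q ∧ Lit.neg q ∉ r.body ∧ q ∉ r.head := by
  constructor
  · rintro (hr | hr | hr)
    · exact ⟨hr.1, fun h => hr.2 (Or.inr ⟨_, h, rfl⟩), fun h => hr.2 (Or.inl h)⟩
    · exact ⟨hr.1, (hQ r hr.1).pos_neg q hr.2, fun h => (hQ r hr.1).head_pos q h hr.2⟩
    · exact ⟨hr.1, fun h => (hQ r hr.1).neg_nneg q h hr.2.1, hr.2.2⟩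
  · rintro ⟨hr, hn, hh⟩
    by_cases hp : Lit.pos q ∈ r.body
    · exact Or.inr (Or.inl ⟨hr, hp⟩)
    by_cases hnn : Lit.nneg q ∈ r.body
    · exact Or.inr (Or.inr ⟨hr, hnn, hh⟩)
    · refine Or.inl ⟨hr, ?_⟩
      rintro (h' | ⟨l, hl, hlq⟩)
      · exact hh h'
      · cases l <;> cases hlq <;> contradiction

theorem mem_R_union_R2_union_R3_union_R4_iff (hQ : ∀ r ∈ Q, r.Reduced) {r : Rule σ} :
    r ∈ R Q q ∪ (R2 Q q ∪ (R3 Q q ∪ R4 Q q)) ↔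
      r ∈ Q ∧ Lit.neg q ∉ r.body ∧ Lit.pos q ∉ r.body := by
  constructor
  · rintro (hr | hr | hr | hr)
    · exact ⟨hr.1, fun h => hr.2 (Or.inr ⟨_, h, rfl⟩), fun h => hr.2 (Or.inr ⟨_, h, rfl⟩)⟩
    · exact ⟨hr.1, fun h => (hQ r hr.1).neg_nneg q h hr.2.1,
        fun h => (hQ r hr.1).pos_nneg q h hr.2.1⟩
    · exact ⟨hr.1, fun h => (hQ r hr.1).neg_nneg q h hr.2.1,
        fun h => (hQ r hr.1).pos_nneg q h hr.2.1⟩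
    · exact ⟨hr.1, (hQ r hr.1).head_neg q hr.2.2, (hQ r hr.1).head_pos q hr.2.2⟩
  · rintro ⟨hr, hn, hp⟩
    by_cases hnn : Lit.nneg q ∈ r.body
    · by_cases hh : q ∈ r.head
      · exact Or.inr (Or.inr (Or.inl ⟨hr, hnn, hh⟩))
      · exact Or.inr (Or.inl ⟨hr, hnn, hh⟩)
    by_cases hh : q ∈ r.head
    · exact Or.inr (Or.inr (Or.inr ⟨hr, hnn, hh⟩))
    · refine Or.inl ⟨hr, ?_⟩
      rintro (h' | ⟨l, hl, hlq⟩)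
      · exact hh h'
      · cases l <;> cases hlq <;> contradiction

theorem forall_hSat_singleton_singleton_iff (hQ : ∀ r ∈ Q, r.Reduced) (hX : q ∉ X) (hq : q ∉ Y) :
    (∀ r ∈ Q, r.HSat (X ∪ {q}) (Y ∪ {q})) ↔
      ∀ r ∈ R Q q ∪ (R0 Q q ∪ R2 Q q), r.HSatWo q X Y := by
  simp only [mem_R_union_R0_union_R2_iff hQ, Rule.hSat_union_iff hX hq subset_rfl subset_rfl,
    Set.mem_singleton_iff, implies_true, not_true_eq_false, imp_false, and_true, forall_const,
    and_imp]

theorem forall_hSat_empty_singleton_iff (hQ : ∀ r ∈ Q, r.Reduced) (hX : q ∉ X) (hq : q ∉ Y) :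
    (∀ r ∈ Q, r.HSat (X ∪ ∅) (Y ∪ {q})) ↔
      ∀ r ∈ R Q q ∪ (R2 Q q ∪ (R3 Q q ∪ R4 Q q)), r.HSatWo q X Y := by
  simp only [mem_R_union_R2_union_R3_union_R4_iff hQ,
    Rule.hSat_union_iff hX hq (Set.empty_subset _) subset_rfl,
    Set.mem_singleton_iff, Set.mem_empty_iff_false, implies_true, not_true_eq_false, imp_false,
    and_false, not_false_eq_true, forall_const, and_imp]
  exact forall₂_congr fun r _ => ⟨fun h a b => h b a, fun h a b => h b a⟩

theorem isHTModel_singleton_singleton_iff (hQ : ∀ r ∈ Q, r.Reduced) (hXY : X ⊆ Y) (hq : q ∉ Y) :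
    IsHTModel Q (X ∪ {q}) (Y ∪ {q}) ↔
      (∀ r ∈ R Q q ∪ (R0 Q q ∪ R2 Q q), r.HSatWo q Y Y) ∧
        ∀ r ∈ R Q q ∪ (R0 Q q ∪ R2 Q q), r.HSatWo q X Y := by
  rw [isHTModel_iff, and_iff_right (Set.union_subset_union_left _ hXY)]
  simp only [forall_and]
  rw [forall_hSat_singleton_singleton_iff hQ hq hq,
    forall_hSat_singleton_singleton_iff hQ (fun h => hq (hXY h)) hq]

theorem isHTModel_empty_singleton_iff (hQ : ∀ r ∈ Q, r.Reduced) (hXY : X ⊆ Y) (hq : q ∉ Y) :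
    IsHTModel Q (X ∪ ∅) (Y ∪ {q}) ↔
      (∀ r ∈ R Q q ∪ (R0 Q q ∪ R2 Q q), r.HSatWo q Y Y) ∧
        ∀ r ∈ R Q q ∪ (R2 Q q ∪ (R3 Q q ∪ R4 Q q)), r.HSatWo q X Y := by
  rw [isHTModel_iff, and_iff_right (Set.union_subset_union hXY (Set.empty_subset _))]
  simp only [forall_and]
  rw [forall_hSat_singleton_singleton_iff hQ hq hq,
    forall_hSat_empty_singleton_iff hQ (fun h => hq (hXY h)) hq]

/-- What membership of `⟨X, Y⟩` among the prescribed models says about the classes of rules. -/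
structure ForgetModel (Q : Program σ) (q : σ) (X Y : Set σ) : Prop where
  subset : X ⊆ Y
  keep : ∀ r ∈ R Q q, r.HSatWo q X Y
  total : (∀ r ∈ R1 Q q ∪ R4 Q q, r.HSatWo q Y Y) ∨
    ((∀ r ∈ R0 Q q ∪ R2 Q q, r.HSatWo q Y Y) ∧ ∃ r ∈ R3 Q q ∪ R4 Q q, ¬ r.HSatWo q Y Y)
  of_false : (∀ r ∈ R1 Q q ∪ R4 Q q, r.HSatWo q Y Y) → ∀ r ∈ R1 Q q ∪ R4 Q q, r.HSatWo q X Y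
  of_true : (∀ r ∈ R0 Q q ∪ R2 Q q, r.HSatWo q Y Y) →
    (∃ r ∈ R3 Q q ∪ R4 Q q, ¬ r.HSatWo q Y Y) →
    (∀ r ∈ R2 Q q ∪ (R3 Q q ∪ R4 Q q), r.HSatWo q X Y) ∨ ∀ r ∈ R0 Q q ∪ R2 Q q, r.HSatWo q X Y

theorem empty_mem_Rel_iff (hQ : ∀ r ∈ Q, r.Reduced) (hq : q ∉ Y) :
    ∅ ∈ Rel Q {q} Y ↔
      (∀ r ∈ R Q q, r.HSatWo q Y Y) ∧ ∀ r ∈ R1 Q q ∪ R4 Q q, r.HSatWo q Y Y := by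
  have h : ∅ ∈ Rel Q {q} Y ↔ IsHTModel Q (Y ∪ ∅) (Y ∪ ∅) :=
    ⟨fun h => h.2.1, fun h => ⟨Set.empty_subset _, h, fun ⟨_, hA, _⟩ => hA.2 (Set.empty_subset _)⟩⟩
  rw [h, isHTModel_empty_empty_iff hQ subset_rfl hq]
  simp only [and_self, Set.mem_union, or_imp, forall_and]

/-- Relevance of {q} asks that ⟨Y, Y ∪ {q}⟩ fail. Since R and R2 already hold by totality, the
failure must come from R3 or R4. -/
theorem singleton_mem_Rel_iff (hQ : ∀ r ∈ Q, r.Reduced) (hq : q ∉ Y) :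
    {q} ∈ Rel Q {q} Y ↔
      (∀ r ∈ R Q q, r.HSatWo q Y Y) ∧ (∀ r ∈ R0 Q q ∪ R2 Q q, r.HSatWo q Y Y) ∧
        ∃ r ∈ R3 Q q ∪ R4 Q q, ¬ r.HSatWo q Y Y := by
  have h : {q} ∈ Rel Q {q} Y ↔
      IsHTModel Q (Y ∪ {q}) (Y ∪ {q}) ∧ ¬ IsHTModel Q (Y ∪ ∅) (Y ∪ {q}) := by
    simp [Rel, Set.ssubset_singleton_iff]
  rw [h, isHTModel_singleton_singleton_iff hQ subset_rfl hq,
    isHTModel_empty_singleton_iff hQ subset_rfl hq]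
  simp only [and_self, Set.mem_union, or_imp, forall_and, or_and_right, exists_or]
  constructor
  · rintro ⟨⟨h1, h2⟩, h3⟩
    refine ⟨h1, h2, ?_⟩
    by_contra! hcon
    exact h3 ⟨⟨h1, h2⟩, h1, h2.2, hcon.1, hcon.2⟩
  · rintro ⟨h1, h2, ⟨r, hr, hv⟩ | ⟨r, hr, hv⟩⟩
    · exact ⟨⟨h1, h2⟩, fun h => hv (h.2.2.2.1 r hr)⟩
    · exact ⟨⟨h1, h2⟩, fun h => hv (h.2.2.2.2 r hr)⟩

theorem forgetModel_of_mem (hQ : ∀ r ∈ Q, r.Reduced) (h : (X, Y) ∈ forgetModels Q {q}) :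
    ForgetModel Q q X Y := by
  obtain ⟨hY, ⟨_, ⟨A, hA, rfl⟩⟩, hX⟩ := h
  have hq : q ∉ Y := fun h => hY h rfl
  -- A witness for X in the family can differ from X only in q, so its "here" part is X or X ∪ {q}.
  have hmem : ∀ A ∈ Rel Q {q} Y, ∃ A' ⊆ ({q} : Set σ), IsHTModel Q (X ∪ A') (Y ∪ A) := by
    intro A hA
    obtain ⟨X', hX', rfl : X = X' \ {q}⟩ := hX _ ⟨A, hA, rfl⟩
    exact ⟨X' ∩ {q}, Set.inter_subset_right, by rwa [Set.sdiff_union_inter]⟩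
  have hqX : q ∉ X := by
    obtain ⟨X', hX', rfl : X = X' \ {q}⟩ := hX _ ⟨A, hA, rfl⟩
    exact fun h => h.2 rfl
  have hXY : X ⊆ Y := by
    obtain ⟨A', hA', hm⟩ := hmem A hA
    intro a ha
    refine ((isHTModel_iff.1 hm).1 (Or.inl ha)).resolve_right fun h' => ?_
    obtain rfl := hA.1 h'
    exact hqX ha
  have hfalse : ∅ ∈ Rel Q {q} Y → ∀ r ∈ R Q q ∪ (R1 Q q ∪ R4 Q q), r.HSatWo q X Y := by
    intro h
    obtain ⟨A', hA', hm⟩ := hmem _ h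
    rcases Set.subset_singleton_iff_eq.1 hA' with rfl | rfl
    · exact fun r hr => ((isHTModel_empty_empty_iff hQ hXY hq).1 hm r hr).2
    · exact absurd ((isHTModel_iff.1 hm).1 (Or.inr rfl)) (by simpa using hq)
  have htrue : {q} ∈ Rel Q {q} Y →
      (∀ r ∈ R Q q ∪ (R2 Q q ∪ (R3 Q q ∪ R4 Q q)), r.HSatWo q X Y) ∨
        ∀ r ∈ R Q q ∪ (R0 Q q ∪ R2 Q q), r.HSatWo q X Y := by
    intro h
    obtain ⟨A', hA', hm⟩ := hmem _ h
    rcases Set.subset_singleton_iff_eq.1 hA' with rfl | rfl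
    · exact Or.inl ((isHTModel_empty_singleton_iff hQ hXY hq).1 hm).2
    · exact Or.inr ((isHTModel_singleton_singleton_iff hQ hXY hq).1 hm).2
  rw [empty_mem_Rel_iff hQ hq] at hfalse
  rw [singleton_mem_Rel_iff hQ hq] at htrue
  have hA' : A = ∅ ∨ A = {q} := Set.subset_singleton_iff_eq.1 hA.1
  have hR : ∀ r ∈ R Q q, r.HSatWo q Y Y := by
    rcases hA' with rfl | rfl
    · exact ((empty_mem_Rel_iff hQ hq).1 hA).1
    · exact ((singleton_mem_Rel_iff hQ hq).1 hA).1
  refine ⟨hXY, ?_, ?_, fun h r hr => hfalse ⟨hR, h⟩ r (Or.inr hr), fun h h' => ?_⟩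
  · intro r hr
    rcases hA' with rfl | rfl
    · exact hfalse ((empty_mem_Rel_iff hQ hq).1 hA) r (Or.inl hr)
    · exact (htrue ((singleton_mem_Rel_iff hQ hq).1 hA)).elim (fun h => h r (Or.inl hr))
        fun h => h r (Or.inl hr)
  · rcases hA' with rfl | rfl
    · exact Or.inl ((empty_mem_Rel_iff hQ hq).1 hA).2
    · exact Or.inr ((singleton_mem_Rel_iff hQ hq).1 hA).2
  · exact (htrue ⟨hR, h, h'⟩).imp (fun h r hr => h r (Or.inr hr)) fun h r hr => h r (Or.inr hr)

/-- R2 belongs to both alternatives of `of_true`: the truth of `not not q` depends only on the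
"there" world. -/
theorem ForgetModel.R2_of_true (hM : ForgetModel Q q X Y)
    (h : ∀ r ∈ R0 Q q ∪ R2 Q q, r.HSatWo q Y Y) (h' : ∃ r ∈ R3 Q q ∪ R4 Q q, ¬ r.HSatWo q Y Y) :
    ∀ r ∈ R2 Q q, r.HSatWo q X Y := fun r hr =>
  (hM.of_true h h').elim (fun h => h r (Or.inl hr)) fun h => h r (Or.inr hr)

end Classes

end Program

/-! ### Negated literal sets and as-duals. -/

theorem hSat_naf_set {X Y : Set σ} {S : Set (Lit σ)} :
    (∀ l ∈ naf S, l.HSat X Y) ↔ ∀ l ∈ S, ¬ l.HSat Y Y := by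
  simp only [naf, Set.forall_mem_image, Lit.hSat_naf]

theorem hSat_nnaf_set {X Y : Set σ} {S : Set (Lit σ)} :
    (∀ l ∈ nnaf S, l.HSat X Y) ↔ ∀ l ∈ S, l.HSat Y Y := by
  simp only [nnaf, Set.forall_mem_image, Lit.hSat_nnaf]

theorem hSat_naf_atomLits {X Y A : Set σ} :
    (∀ l ∈ naf (atomLits A), l.HSat X Y) ↔ ∀ a ∈ A, a ∉ Y := by
  rw [hSat_naf_set]
  simp only [atomLits, Set.forall_mem_image, Lit.hSat_pos]

theorem hSat_union_set {X Y : Set σ} {S T : Set (Lit σ)} :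
    (∀ l ∈ S ∪ T, l.HSat X Y) ↔ (∀ l ∈ S, l.HSat X Y) ∧ ∀ l ∈ T, l.HSat X Y := by
  simp only [Set.mem_union, or_imp, forall_and]

theorem Rule.not_hSatWo {q : σ} {Y : Set σ} {r : Rule σ} (hb : ∀ l ∈ r.bodyWo q, l.HSat Y Y)
    (hh : ∀ a ∈ r.headWo q, a ∉ Y) : ¬ r.HSatWo q Y Y := fun h =>
  let ⟨a, ha, haY⟩ := h hb
  hh a ha haY

theorem Rule.hSatWo_of_mem {q a : σ} {X Y : Set σ} {r : Rule σ} (ha : a ∈ r.headWo q)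
    (haX : a ∈ X) : r.HSatWo q X Y := fun _ => ⟨a, ha, haX⟩

namespace Program

/-- A true as-dual certifies, rule by rule, a false body literal or a true head atom at Y. -/
theorem hSatWo_of_mem_asDual {q : σ} {X Y : Set σ} {P : Program σ} {D : Set (Lit σ)}
    (hD : D ∈ asDual q P) (h : ∀ l ∈ D, l.HSat X Y) : ∀ r ∈ P, r.HSatWo q Y Y := by
  obtain ⟨F, T, rfl, -, l, hF, hT, rfl⟩ := hD
  rw [hSat_union_set, hSat_naf_set, hSat_nnaf_set] at h
  rintro r (hr | hr) hb
  · exact absurd (hb _ (hF r hr)) (h.1 _ ⟨r, hr, rfl⟩)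
  · obtain ⟨a, ha, hal⟩ := hT r hr
    have := h.2 _ ⟨r, hr, rfl⟩
    rw [← hal] at this
    exact ⟨a, ha, this⟩

/-- The rule left out of the as-dual is covered by its head atom `a`; this is the role of the
literal `not not h` in (3a), (3b), (6) and (7). -/
theorem hSatWo_of_mem_asDual_diff {q a : σ} {X Y : Set σ} {P : Program σ} {r : Rule σ}
    {D : Set (Lit σ)} (hD : D ∈ asDual q (P \ {r})) (h : ∀ l ∈ D, l.HSat X Y)
    (ha : a ∈ r.headWo q) (haY : a ∈ Y) : ∀ s ∈ P, s.HSatWo q Y Y := by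
  intro s hs
  by_cases hsr : s = r
  · exact hsr ▸ Rule.hSatWo_of_mem ha haY
  · exact hSatWo_of_mem_asDual hD h s ⟨hs, hsr⟩

theorem naf_atom_ne {q : σ} {S : Set (Lit σ)} (h : ∀ l ∈ S, l.atom ≠ q) :
    ∀ l ∈ naf S, l.atom ≠ q := by
  simpa only [naf, Set.forall_mem_image, Lit.atom_naf] using h

theorem nnaf_atom_ne {q : σ} {S : Set (Lit σ)} (h : ∀ l ∈ S, l.atom ≠ q) :
    ∀ l ∈ nnaf S, l.atom ≠ q := by
  simpa only [nnaf, Set.forall_mem_image, Lit.atom_nnaf] using h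

theorem atomLits_atom_ne {q : σ} {A : Set σ} (h : q ∉ A) : ∀ l ∈ atomLits A, l.atom ≠ q := by
  rintro _ ⟨a, ha, rfl⟩ rfl
  exact h ha

theorem bodyWo_atom_ne {q : σ} {r : Rule σ} : ∀ l ∈ r.bodyWo q, l.atom ≠ q :=
  fun _ hl => (Rule.mem_bodyWo.1 hl).2

theorem union_atom_ne {q : σ} {S T : Set (Lit σ)} (hS : ∀ l ∈ S, l.atom ≠ q)
    (hT : ∀ l ∈ T, l.atom ≠ q) : ∀ l ∈ S ∪ T, l.atom ≠ q :=
  fun l hl => hl.elim (hS l) (hT l)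

theorem singleton_atom_ne {q : σ} {l : Lit σ} (h : l.atom ≠ q) :
    ∀ k ∈ ({l} : Set (Lit σ)), k.atom ≠ q := by
  rintro _ rfl
  exact h

theorem notMem_headWo {q : σ} {r : Rule σ} : q ∉ r.headWo q := fun h => h.2 rfl

theorem asDual_atom_ne {q : σ} {P : Program σ} {D : Set (Lit σ)} (hD : D ∈ asDual q P) :
    ∀ l ∈ D, l.atom ≠ q := by
  obtain ⟨F, T, -, -, l, hF, hT, rfl⟩ := hD
  refine union_atom_ne (naf_atom_ne ?_) (nnaf_atom_ne ?_)
  · rintro _ ⟨r, hr, rfl⟩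
    exact bodyWo_atom_ne _ (hF r hr)
  · rintro _ ⟨r, hr, rfl⟩
    exact atomLits_atom_ne notMem_headWo _ (hT r hr)

/-! ### Derived rules: absence of q and soundness. -/

section Derived

variable {Q : Program σ} {q : σ}

theorem notMem_head_of_mem_R0 (hQ : ∀ r ∈ Q, r.Reduced) {r : Rule σ} (hr : r ∈ R0 Q q) :
    q ∉ r.head := fun h => (hQ r hr.1).head_pos q h hr.2

theorem notMem_head_of_mem_R0_union_R2 (hQ : ∀ r ∈ Q, r.Reduced) {r : Rule σ}
    (hr : r ∈ R0 Q q ∪ R2 Q q) : q ∉ r.head :=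
  hr.elim (notMem_head_of_mem_R0 hQ) fun h => h.2.2

theorem bodyWo_of_mem_R4 (hQ : ∀ r ∈ Q, r.Reduced) {r : Rule σ} (hr : r ∈ R4 Q q) :
    r.bodyWo q = r.body := by
  ext l
  rw [Rule.mem_bodyWo, and_iff_left_iff_imp]
  intro hl hlq
  cases l with
  | pos a => cases hlq; exact (hQ r hr.1).head_pos _ hr.2.2 hl
  | neg a => cases hlq; exact (hQ r hr.1).head_neg _ hr.2.2 hl
  | nneg a => cases hlq; exact hr.2.1 hl

theorem headWo_eq {r : Rule σ} (h : q ∉ r.head) : r.headWo q = r.head :=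
  Set.sdiff_singleton_eq_self h

theorem notMem_atoms {H : Set σ} {B : Set (Lit σ)} (hH : q ∉ H) (hB : ∀ l ∈ B, l.atom ≠ q) :
    q ∉ (Rule.mk H B).atoms := by
  rintro (h | ⟨l, hl, hlq⟩)
  · exact hH h
  · exact hB l hl hlq

theorem Derived.notMem_atoms (hQ : ∀ r ∈ Q, r.Reduced) {r : Rule σ} (hr : Derived Q q r) :
    q ∉ r.atoms := by
  cases hr with
  | keep r hr => exact hr.2
  | d1a r₀ r₄ h₀ h₄ =>
    refine Program.notMem_atoms (fun h => h.elim (notMem_head_of_mem_R0 hQ h₀) notMem_headWo) ?_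
    rw [← bodyWo_of_mem_R4 hQ h₄]
    exact union_atom_ne bodyWo_atom_ne bodyWo_atom_ne
  | d2a r₀ r₃ r' h₀ h₃ h' =>
    refine Program.notMem_atoms (fun h => h.elim (notMem_head_of_mem_R0 hQ h₀) notMem_headWo) ?_
    exact union_atom_ne (union_atom_ne (union_atom_ne bodyWo_atom_ne bodyWo_atom_ne)
      (naf_atom_ne (atomLits_atom_ne notMem_headWo))) (nnaf_atom_ne bodyWo_atom_ne)
  | d3a r₀ r₃ a D h₀ h₃ ha hD =>
    have hq := notMem_head_of_mem_R0 hQ h₀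
    refine Program.notMem_atoms hq ?_
    refine union_atom_ne (union_atom_ne (union_atom_ne (union_atom_ne bodyWo_atom_ne
      (singleton_atom_ne ?_)) (asDual_atom_ne hD)) bodyWo_atom_ne)
      (naf_atom_ne (atomLits_atom_ne notMem_headWo))
    rintro rfl
    exact hq ha
  | d1b r₂ r₄ h₂ h₄ =>
    refine Program.notMem_atoms h₂.2.2 ?_
    rw [← bodyWo_of_mem_R4 hQ h₄]
    exact union_atom_ne (union_atom_ne bodyWo_atom_ne
      (naf_atom_ne (atomLits_atom_ne notMem_headWo))) (nnaf_atom_ne bodyWo_atom_ne)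
  | d2b r₂ r₃ r' h₂ h₃ h' =>
    refine Program.notMem_atoms h₂.2.2 ?_
    exact union_atom_ne (union_atom_ne bodyWo_atom_ne
      (naf_atom_ne (atomLits_atom_ne fun h => h.elim notMem_headWo notMem_headWo)))
      (nnaf_atom_ne (union_atom_ne bodyWo_atom_ne bodyWo_atom_ne))
  | d3b r₂ r₃ a D h₂ h₃ ha hD =>
    refine Program.notMem_atoms h₂.2.2 ?_
    refine union_atom_ne (union_atom_ne (union_atom_ne bodyWo_atom_ne
      (naf_atom_ne (atomLits_atom_ne notMem_headWo)))
      (nnaf_atom_ne (union_atom_ne bodyWo_atom_ne (singleton_atom_ne ?_)))) (asDual_atom_ne hD)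
    rintro rfl
    exact h₂.2.2 ha
  | d4 r' D h' hD hdisj =>
    exact Program.notMem_atoms notMem_headWo (union_atom_ne bodyWo_atom_ne (asDual_atom_ne hD))
  | d5 r' r₃ s D h' h₃ hs hD hdisj =>
    refine Program.notMem_atoms notMem_headWo ?_
    exact union_atom_ne (union_atom_ne (union_atom_ne bodyWo_atom_ne
      (naf_atom_ne (atomLits_atom_ne
        fun h => h.elim (notMem_head_of_mem_R0_union_R2 hQ hs) notMem_headWo)))
      (nnaf_atom_ne (union_atom_ne bodyWo_atom_ne bodyWo_atom_ne))) (asDual_atom_ne hD)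
  | d6 r' r₃ a D h' h₃ ha hD =>
    refine Program.notMem_atoms notMem_headWo ?_
    exact union_atom_ne (union_atom_ne (union_atom_ne bodyWo_atom_ne
      (naf_atom_ne (atomLits_atom_ne notMem_headWo)))
      (nnaf_atom_ne (union_atom_ne bodyWo_atom_ne (singleton_atom_ne fun h => ha.2 h))))
      (asDual_atom_ne hD)
  | d7 r₀ r₃ r₃' a D h₀ h₃ h₃' hne hD ha =>
    have hq := notMem_head_of_mem_R0 hQ h₀
    refine Program.notMem_atoms (fun h => h.elim hq notMem_headWo) ?_
    refine union_atom_ne (union_atom_ne (union_atom_ne (union_atom_ne bodyWo_atom_ne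
      bodyWo_atom_ne) (naf_atom_ne (atomLits_atom_ne notMem_headWo)))
      (nnaf_atom_ne (union_atom_ne bodyWo_atom_ne (singleton_atom_ne ?_)))) (asDual_atom_ne hD)
    rintro rfl
    exact hq ha

/-- Every derived rule holds in every prescribed model. -/
theorem Derived.hSat (hQ : ∀ r ∈ Q, r.Reduced) {r : Rule σ} (hr : Derived Q q r) {X Y : Set σ}
    (hM : ForgetModel Q q X Y) : r.HSat X Y := by
  cases hr with
  | keep r hr => exact (Rule.hSatWo_iff_hSat hr.2).1 (hM.keep r hr)
  | d1a r₀ r₄ h₀ h₄ =>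
    rintro hb
    simp only [hSat_union_set] at hb
    have h4 : r₄.HSatWo q X Y → ∃ a ∈ r₀.head ∪ r₄.headWo q, a ∈ X := fun h =>
      let ⟨a, ha, haX⟩ := h fun l hl => hb.2 l hl.1
      ⟨a, Or.inr ha, haX⟩
    -- Whichever status of q is relevant, either the q-free part of `r₀` or that of `r₄` holds at
    -- ⟨X, Y⟩.
    rcases hM.total with h | ⟨h, h'⟩
    · exact h4 (hM.of_false h r₄ (Or.inr h₄))
    · rcases hM.of_true h h' with h | h
      · exact h4 (h r₄ (Or.inr (Or.inr h₄)))
      · obtain ⟨a, ha, haX⟩ := h r₀ (Or.inl h₀) hb.1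
        exact ⟨a, Or.inl ha.1, haX⟩
  | d2a r₀ r₃ r' h₀ h₃ h' =>
    rintro hb
    simp only [hSat_union_set, hSat_naf_atomLits, hSat_nnaf_set] at hb
    obtain ⟨⟨⟨hb0, hb3⟩, hh'⟩, hb'⟩ := hb
    -- The negated part of the body says that `r'` fails at Y, which rules out q false and leaves q
    -- true.
    obtain ⟨h, h''⟩ := hM.total.resolve_left fun h => Rule.not_hSatWo hb' hh' (h r' h')
    rcases hM.of_true h h'' with h | h
    · obtain ⟨a, ha, haX⟩ := h r₃ (Or.inr (Or.inl h₃)) hb3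
      exact ⟨a, Or.inr ha, haX⟩
    · obtain ⟨a, ha, haX⟩ := h r₀ (Or.inl h₀) hb0
      exact ⟨a, Or.inl ha.1, haX⟩
  | d3a r₀ r₃ a D h₀ h₃ ha hD =>
    rintro hb
    simp only [hSat_union_set, hSat_naf_atomLits, Set.mem_singleton_iff, forall_eq,
      Lit.hSat_nneg] at hb
    obtain ⟨⟨⟨⟨hb0, haY⟩, hbD⟩, hb3⟩, hh3⟩ := hb
    rw [← headWo_eq (notMem_head_of_mem_R0 hQ h₀)] at ha
    rcases hM.of_true (hSatWo_of_mem_asDual_diff hD hbD ha haY)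
      ⟨r₃, Or.inl h₃, Rule.not_hSatWo (fun l hl => (hb3 l hl).mono hM.subset) hh3⟩ with h | h
    · obtain ⟨b, hb, hbX⟩ := h r₃ (Or.inr (Or.inl h₃)) hb3
      -- The alternative with q false here would put a head atom of `r₃` into Y, against the negated
      -- head in the body.
      exact absurd (hM.subset hbX) (hh3 b hb)
    · obtain ⟨b, hb, hbX⟩ := h r₀ (Or.inl h₀) hb0
      exact ⟨b, hb.1, hbX⟩
  | d1b r₂ r₄ h₂ h₄ =>
    rintro hb
    simp only [hSat_union_set, hSat_naf_atomLits, hSat_nnaf_set] at hb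
    obtain ⟨⟨hb2, hh4⟩, hb4⟩ := hb
    obtain ⟨h, h'⟩ := hM.total.resolve_left fun h =>
      Rule.not_hSatWo (fun l hl => hb4 l hl.1) hh4 (h r₄ (Or.inr h₄))
    obtain ⟨b, hb, hbX⟩ := hM.R2_of_true h h' r₂ h₂ hb2
    exact ⟨b, hb.1, hbX⟩
  | d2b r₂ r₃ r' h₂ h₃ h' =>
    rintro hb
    simp only [hSat_union_set, hSat_naf_atomLits, hSat_nnaf_set] at hb
    obtain ⟨⟨hb2, hh⟩, -, hb'⟩ := hb
    obtain ⟨h, h''⟩ := hM.total.resolve_left fun h =>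
      Rule.not_hSatWo hb' (fun a ha => hh a (Or.inr ha)) (h r' h')
    obtain ⟨b, hb, hbX⟩ := hM.R2_of_true h h'' r₂ h₂ hb2
    exact ⟨b, hb.1, hbX⟩
  | d3b r₂ r₃ a D h₂ h₃ ha hD =>
    rintro hb
    simp only [hSat_union_set, hSat_naf_atomLits, hSat_nnaf_set, Set.mem_singleton_iff,
      forall_eq, Lit.hSat_pos] at hb
    obtain ⟨⟨⟨hb2, hh3⟩, hb3, haY⟩, hbD⟩ := hb
    rw [← headWo_eq h₂.2.2] at ha
    obtain ⟨b, hb, hbX⟩ := hM.R2_of_true (hSatWo_of_mem_asDual_diff hD hbD ha haY)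
      ⟨r₃, Or.inl h₃, Rule.not_hSatWo hb3 hh3⟩ r₂ h₂ hb2
    exact ⟨b, hb.1, hbX⟩
  | d4 r' D h' hD hdisj =>
    rintro hb
    simp only [hSat_union_set] at hb
    -- q true would need a rule of R3 ∪ R4 violated at Y, and the as-dual forbids it.
    refine hM.of_false (hM.total.resolve_right ?_) r' h' hb.1
    rintro ⟨-, s, hs, hns⟩
    exact hns (hSatWo_of_mem_asDual hD hb.2 s hs)
  | d5 r' r₃ s D h' h₃ hs hD hdisj =>
    rintro hb
    simp only [hSat_union_set, hSat_naf_atomLits, hSat_nnaf_set] at hb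
    obtain ⟨⟨⟨hb', hh⟩, hbs, -⟩, -⟩ := hb
    refine hM.of_false (hM.total.resolve_right fun h => ?_) r' h' hb'
    -- Here q true is excluded because `s` fails at Y.
    exact Rule.not_hSatWo hbs (fun a ha => hh a (Or.inl ha.1)) (h.1 s hs)
  | d6 r' r₃ a D h' h₃ ha hD =>
    rintro hb
    simp only [hSat_union_set, hSat_naf_atomLits, hSat_nnaf_set, Set.mem_singleton_iff,
      forall_eq, Lit.hSat_pos] at hb
    obtain ⟨⟨⟨hb', -⟩, -, haY⟩, hbD⟩ := hb
    exact hM.of_false (hSatWo_of_mem_asDual_diff hD hbD ha haY) r' h' hb'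
  | d7 r₀ r₃ r₃' a D h₀ h₃ h₃' hne hD ha =>
    rintro hb
    simp only [hSat_union_set, hSat_naf_atomLits, hSat_nnaf_set, Set.mem_singleton_iff,
      forall_eq, Lit.hSat_pos] at hb
    obtain ⟨⟨⟨⟨hb0, hb3⟩, hh3'⟩, hb3', haY⟩, hbD⟩ := hb
    rw [← headWo_eq (notMem_head_of_mem_R0 hQ h₀)] at ha
    rcases hM.of_true (hSatWo_of_mem_asDual_diff hD hbD ha haY)
      ⟨r₃', Or.inl h₃', Rule.not_hSatWo hb3' hh3'⟩ with h | h
    · obtain ⟨b, hb, hbX⟩ := h r₃ (Or.inr (Or.inl h₃)) hb3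
      exact ⟨b, Or.inr hb, hbX⟩
    · obtain ⟨b, hb, hbX⟩ := h r₀ (Or.inl h₀) hb0
      exact ⟨b, Or.inl hb.1, hbX⟩

end Derived

theorem hSat_of_mem_fSP [Finite σ] {P : Program σ} {q : σ} {r : Rule σ} (hr : r ∈ fSP P q)
    {X Y : Set σ} (h : (X, Y) ∈ forgetModels P {q}) : r.HSat X Y := by
  have hQ : ∀ s ∈ NF P, s.Reduced := fun s => reduced_of_mem_NF
  rw [← forgetModels_NF] at h
  have hM := forgetModel_of_mem hQ h
  exact (forall_NF_hSat_iff hM.subset).2 (fun s hs => Derived.hSat hQ hs hM) r hr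

theorem notMem_atoms_of_mem_fSP {P : Program σ} {q : σ} {r : Rule σ} (hr : r ∈ fSP P q) :
    q ∉ r.atoms := by
  obtain ⟨⟨s, ⟨hs, -⟩, rfl⟩, -⟩ := hr
  have hq := Derived.notMem_atoms (fun s => reduced_of_mem_NF) hs
  rintro (h | ⟨l, hl, hlq⟩)
  · exact hq (Or.inl h.1)
  · exact hq (Or.inr ⟨l, hl.1, hlq⟩)

/-! ### Counting counter-model rules. -/

theorem pbody_counterRule (S X Y : Set σ) : (counterRule S X Y).pbody = X := by
  ext a
  simp [counterRule, Rule.pbody, atomLits, naf, nnaf, Lit.naf, Lit.nnaf]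

/-- This lets Y be recovered from its counter-model rule, so distinct Y force distinct rules. -/
theorem head_union_pbody_counterRule (S : Set σ) {X Y : Set σ} (hXY : X ⊆ Y) :
    (counterRule S X Y).head ∪ (counterRule S X Y).pbody = Y := by
  rw [pbody_counterRule]
  exact Set.sdiff_union_of_subset hXY

/-- An excluded interpretation `⟨X, Y⟩` gives rise to a counter-model rule for `Y`. -/
theorem exists_mem_fSem {P : Program σ} {V X Y : Set σ} (hXY : X ⊆ Y) (hY : Y ⊆ Vᶜ)
    (h : (X, Y) ∉ forgetModels P V) : ∃ s ∈ fSem P V, s.head ∪ s.pbody = Y := by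
  by_cases hYY : (Y, Y) ∈ forgetModels P V
  · exact ⟨_, Or.inl ⟨X, Y, hXY, hY, h, hYY, rfl⟩, head_union_pbody_counterRule _ hXY⟩
  · exact ⟨_, Or.inr ⟨Y, hY, hYY, rfl⟩, head_union_pbody_counterRule _ subset_rfl⟩

/-- The atoms that occur neither in the body of a rule nor in `V` may be added freely to the
counter-models of the rule. -/
theorem two_pow_le_ncard_fSem [Finite σ] {P : Program σ} {q : σ} {r : Rule σ} (hr : r ∈ fSP P q)
    {W : Set σ} (hq : q ∉ W) (hW : ∀ l ∈ r.body, l.atom ∉ W) :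
    2 ^ W.ncard ≤ (fSem P {q}).ncard := by
  have hred : r.Reduced := reduced_of_mem_NF hr
  have hqr := notMem_atoms_of_mem_fSP hr
  have hqb : ∀ l ∈ r.body, l.atom ≠ q := fun l hl h => hqr (Or.inr ⟨l, hl, h⟩)
  have hdisj : Disjoint (r.pbody ∪ r.nnbody) W := by
    rw [Set.disjoint_left]
    rintro a (ha | ha) haW
    · exact hW _ ha haW
    · exact hW _ ha haW
  have hinj : Set.InjOn (fun S => r.pbody ∪ r.nnbody ∪ S) (𝒫 W) := by
    intro S hS T hT hST
    have h1 := (Set.union_sdiff_cancel_left (Set.disjoint_iff.1 (hdisj.mono_right hS)))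
    have h2 := (Set.union_sdiff_cancel_left (Set.disjoint_iff.1 (hdisj.mono_right hT)))
    rw [← h1, ← h2]
    exact congrArg (· \ (r.pbody ∪ r.nnbody)) hST
  have hsub : (fun S => r.pbody ∪ r.nnbody ∪ S) '' (𝒫 W) ⊆
      (fun s : Rule σ => s.head ∪ s.pbody) '' fSem P {q} := by
    rintro _ ⟨S, hS, rfl⟩
    -- This pair makes the body of `r` true with the smallest possible "here" world; head atoms may
    -- lie in Y without harm, since only X decides the head.
    obtain ⟨s, hs, hsY⟩ := exists_mem_fSem (P := P) (V := {q}) (X := r.pbody)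
      (Y := r.pbody ∪ r.nnbody ∪ S) (fun a ha => Or.inl (Or.inl ha)) (by
        rintro a ((ha | ha) | ha) rfl
        · exact hqb _ ha rfl
        · exact hqb _ ha rfl
        · exact hq (hS ha)) (by
        intro hM
        obtain ⟨a, ha, haX⟩ := hSat_of_mem_fSP hr hM (by
          intro l hl
          cases l with
          | pos a => exact hl
          | neg a =>
            rintro ((ha | ha) | ha)
            · exact hred.pos_neg a ha hl
            · exact hred.neg_nneg a hl ha
            · exact hW _ hl (hS ha)
          | nneg a => exact Or.inl (Or.inr hl))
        exact hred.head_pos a ha haX)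
    exact ⟨s, hs, hsY⟩
  calc 2 ^ W.ncard = (𝒫 W).ncard := (Set.ncard_powerset W).symm
    _ = ((fun S => r.pbody ∪ r.nnbody ∪ S) '' (𝒫 W)).ncard := hinj.ncard_image.symm
    _ ≤ ((fun s : Rule σ => s.head ∪ s.pbody) '' fSem P {q}).ncard :=
      Set.ncard_le_ncard hsub (Set.toFinite _)
    _ ≤ (fSem P {q}).ncard := Set.ncard_image_le (Set.toFinite _)

end Program

end ASPForget

/-! ### The two bounds. -/

theorem mainTheorem10 {σ : Type*} [Finite σ] (P : ASPForget.Program σ) (q : σ)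
    (r : ASPForget.Rule σ) (hr : r ∈ ASPForget.Program.fSP P q) :
    2 ^ min r.head.ncard (({q}ᶜ : Set σ) \ r.atoms).ncard
        ≤ (ASPForget.Program.fSem P {q}).ncard ∧
    (¬ r.head ⊆ r.nnbody →
      2 ^ min r.head.ncard ((Set.univ : Set σ) \ r.atoms).ncard
        ≤ (ASPForget.Program.fSem P {q}).ncard) := by
  have hbody : ∀ l ∈ r.body, l.atom ∈ r.atoms := fun l hl => Or.inr ⟨l, hl, rfl⟩
  have hqr := ASPForget.Program.notMem_atoms_of_mem_fSP hr
  constructor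
  · refine (Nat.pow_le_pow_right two_pos (min_le_right _ _)).trans ?_
    exact ASPForget.Program.two_pow_le_ncard_fSem hr (fun h => h.1 rfl)
      fun l hl h => h.2 (hbody l hl)
  · intro hne
    obtain ⟨a, ha, hann⟩ := Set.not_subset.1 hne
    have hred := ASPForget.Program.reduced_of_mem_NF hr
    have haq : a ≠ q := fun h => hqr (Or.inl (h ▸ ha))
    -- q is absent from `r`, so Σ \ Σ(r) contains it; trading q for the head atom `a` keeps the
    -- cardinality and gives a set avoiding q.
    have hcard : ((Set.univ : Set σ) \ r.atoms).ncard =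
        (insert a (({q}ᶜ : Set σ) \ r.atoms)).ncard := by
      have huniv : (Set.univ : Set σ) \ r.atoms = insert q (({q}ᶜ : Set σ) \ r.atoms) := by
        ext b
        by_cases hb : b = q <;> simp [hb, hqr]
      rw [huniv, Set.ncard_insert_of_notMem (fun h => h.1 rfl) (Set.toFinite _),
        Set.ncard_insert_of_notMem (fun h => h.2 (Or.inl ha)) (Set.toFinite _)]
    refine (Nat.pow_le_pow_right two_pos (min_le_right _ _)).trans ?_
    rw [hcard]
    refine ASPForget.Program.two_pow_le_ncard_fSem hr ?_ ?_
    · rintro (h | h)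
      · exact haq h.symm
      · exact h.1 rfl
    -- The normal form keeps `a` and `not a` out of the body because `a` is in the head, and `not
    -- not a` is excluded by the choice of `a`.
    · rintro l hl (h | h)
      · cases l with
        | pos b => cases h; exact hred.head_pos _ ha hl
        | neg b => cases h; exact hred.head_neg _ ha hl
        | nneg b => cases h; exact hann hl
      · exact h.2 (hbody l hl)
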